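/- Let $n\ge 1$ be odd and let $D\subset\mathbb R^n$ be a bounded domain (nonempty, open, connected) with $C^\infty$ boundary. For $\omega\in S^{n-1}$ and $t\in\mathbb R$ let $V_D(\omega,t)$ be the $(n-1)$-dimensional volume of $D\cap\{x:\langle\omega,x\rangle=t\}$. Suppose that $D$ is polynomially integrable, that is, there are an integer $N\ge 0$ and functions $a_0,\dots,a_N:S^{n-1}\to\mathbb R$ such that $V_D(\omega,t)=\sum_{j=0}^N a_j(\omega)t^j$ for all $(\omega,t)\in S^{n-1}\times\mathbb R$ for which the hyperplane $\{x:\langle\omega,x\rangle=t\}$ meets $D$. Then for almost every $\omega\in S^{n-1}$ (with respect to surface measure) the (unique) polynomial in $t$ that coincides with $V_D(\omega,t)$ for all such $t$ has degree at least $n-1$. In particular, there are no polynomially integrable bounded domains with $C^\infty$ boundary in $\mathbb R^n$ of degree less than $n-1$, where $D$ is said to be of degree $N$ if a representation as above holds with $a_N$ not identically zero. -/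

import Mathlib

open MeasureTheory Polynomial
open scoped RealInnerProductSpace

/-- `D` is a bounded domain (a nonempty connected open set) in `ℝⁿ` with `C^∞` boundary: near each
of its boundary points `D` is the set where a smooth function without critical points is negative. -/
structure IsSmoothlyBoundedDomain {n : ℕ} (D : Set (EuclideanSpace ℝ (Fin n))) : Prop where
  isOpen : IsOpen D
  isConnected : IsConnected D
  isBounded : Bornology.IsBounded D
  smooth_boundary : ∀ x ∈ frontier D, ∃ (U : Set (EuclideanSpace ℝ (Fin n)))
    (ρ : EuclideanSpace ℝ (Fin n) → ℝ), IsOpen U ∧ x ∈ U ∧ ContDiffOn ℝ ((⊤ : ℕ∞) : WithTop ℕ∞) ρ U ∧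
      (∀ y ∈ U, fderiv ℝ ρ y ≠ 0) ∧ D ∩ U = {y ∈ U | ρ y < 0}

/-- The section-volume function `V_D(ω, t)` for a unit vector `ω`: the `(n-1)`-dimensional Lebesgue
measure of `D ∩ {x | ⟪ω, x⟫ = t}`. The hyperplane is parametrized isometrically by
`y ↦ y + t • ω`, with `y` in the orthogonal complement of `ω`, whose measure is the one that gives
volume one to a cube spanned by an orthonormal basis. -/
noncomputable def sectionVolume {n : ℕ} (D : Set (EuclideanSpace ℝ (Fin n)))
    (ω : Metric.sphere (0 : EuclideanSpace ℝ (Fin n)) 1) (t : ℝ) : ℝ :=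
  (@volume ((ℝ ∙ (ω : EuclideanSpace ℝ (Fin n)))ᗮ) measureSpaceOfInnerProductSpace).real
    {y | (y : EuclideanSpace ℝ (Fin n)) + t • (ω : EuclideanSpace ℝ (Fin n)) ∈ D}

/-- The hyperplane `{x | ⟪ω, x⟫ = t}` hits `D`. -/
def HyperplaneHits {n : ℕ} (D : Set (EuclideanSpace ℝ (Fin n)))
    (ω : Metric.sphere (0 : EuclideanSpace ℝ (Fin n)) 1) (t : ℝ) : Prop :=
  ∃ x ∈ D, ⟪(ω : EuclideanSpace ℝ (Fin n)), x⟫ = t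

/-- `V_D(ω, t) = a₀(ω) + a₁(ω) t + ⋯ + a_N(ω) t^N` whenever the hyperplane `⟪ω, x⟫ = t` hits `D`;
no condition is imposed on the dependence of the coefficients on `ω`. -/
def HasPolynomialSections {n : ℕ} (D : Set (EuclideanSpace ℝ (Fin n))) (N : ℕ)
    (a : ℕ → Metric.sphere (0 : EuclideanSpace ℝ (Fin n)) 1 → ℝ) : Prop :=
  ∀ (ω : Metric.sphere (0 : EuclideanSpace ℝ (Fin n)) 1) (t : ℝ), HyperplaneHits D ω t →
    sectionVolume D ω t = ∑ j ∈ Finset.range (N + 1), a j ω * t ^ j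

/-- `D` is polynomially integrable. -/
def IsPolynomiallyIntegrable {n : ℕ} (D : Set (EuclideanSpace ℝ (Fin n))) : Prop :=
  ∃ N a, HasPolynomialSections D N a

/-- `D` is polynomially integrable of degree `N`: the leading coefficient `a_N` is not identically
zero. -/
def IsPolynomiallyIntegrableOfDegree {n : ℕ} (D : Set (EuclideanSpace ℝ (Fin n))) (N : ℕ) : Prop :=
  ∃ a, HasPolynomialSections D N a ∧ ∃ ω, a N ω ≠ 0

/-- `p` is the polynomial `V_D(ω, ·)`: it agrees with the section-volume function for all `t` for
which the hyperplane `⟪ω, x⟫ = t` hits `D`. -/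
def IsSectionPolynomial {n : ℕ} (D : Set (EuclideanSpace ℝ (Fin n)))
    (ω : Metric.sphere (0 : EuclideanSpace ℝ (Fin n)) 1) (p : ℝ[X]) : Prop :=
  ∀ t : ℝ, HyperplaneHits D ω t → sectionVolume D ω t = p.eval t

open Filter Topology

/-! Let `K` be the closed convex hull of `D`. For almost every `ω`, `K` lies in paraboloids with
outer normals `ω` and `-ω` (`ae_insideParaboloid`). The section at distance `s` from either support
hyperplane then has diameter `O(√s)`, hence volume `O(s^m)` with `n - 1 = 2 * m`. So the section
polynomial vanishes to order `m` at both ends of its interval; being nonzero, it has degree at least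
`2 * m`.

The paraboloids come from the residual `z ↦ z - P z` of the metric projection `P` onto `K`: a
1-Lipschitz surjection, and a gradient of a convex function. By Rademacher and Sard almost every `v`
is its value at a point with invertible derivative, where it expands distances; this makes `K` curve
away quadratically. -/

/-- The set `K` lies in a paraboloid with vertex at one of its points `x` and outer normal `v`. -/
def InsideParaboloid {E : Type*} [NormedAddCommGroup E] [InnerProductSpace ℝ E]
    (K : Set E) (v : E) : Prop :=
  ∃ x ∈ K, ∃ C > 0, ∀ y ∈ K, ‖y - x‖ ^ 2 ≤ C * ⟪v, x - y⟫

/-! ### Residual of the metric projection onto a convex set -/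

section Projection

variable {E : Type*} [NormedAddCommGroup E] [InnerProductSpace ℝ E]

/-- A metric projection onto a nonempty closed convex set. -/
theorem exists_metricProjection [CompleteSpace E] {K : Set E} (hne : K.Nonempty)
    (hcl : IsClosed K) (hconv : Convex ℝ K) :
    ∃ P : E → E, (∀ z, P z ∈ K) ∧ ∀ z, ∀ y ∈ K, ⟪z - P z, y - P z⟫ ≤ 0 := by
  choose P hP using exists_norm_eq_iInf_of_complete_convex hne hcl.isComplete hconv
  exact ⟨P, fun z => (hP z).1, fun z =>
    (norm_eq_iInf_iff_real_inner_le_zero hconv (hP z).1).1 (hP z).2⟩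

variable {K : Set E} {P : E → E} (hPK : ∀ z, P z ∈ K)
  (hP : ∀ z, ∀ y ∈ K, ⟪z - P z, y - P z⟫ ≤ 0)

include hPK hP

theorem norm_sq_residual_sub_le (a b : E) :
    ‖(a - P a) - (b - P b)‖ ^ 2 ≤ ⟪(a - P a) - (b - P b), a - b⟫ := by
  have h1 := hP a (P b) (hPK b)
  have h2 := hP b (P a) (hPK a)
  have h3 : ⟪(a - P a) - (b - P b), a - b⟫ = ‖(a - P a) - (b - P b)‖ ^ 2
      - ⟪a - P a, P b - P a⟫ - ⟪b - P b, P a - P b⟫ := by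
    rw [← real_inner_self_eq_norm_sq]
    simp only [inner_sub_left, inner_sub_right]
    ring
  linarith

theorem lipschitzWith_residual : LipschitzWith 1 (fun z => z - P z) := by
  refine LipschitzWith.of_dist_le_mul fun a b => ?_
  simp only [dist_eq_norm, NNReal.coe_one, one_mul]
  have h1 := norm_sq_residual_sub_le hPK hP a b
  have h2 := real_inner_le_norm ((a - P a) - (b - P b)) (a - b)
  by_contra! h
  nlinarith [norm_nonneg (a - b)]

/-- The function `z ↦ ‖z - P z‖² / 2` is convex with gradient `z - P z`. -/
theorem norm_sq_residual_add_le (a w : E) :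
    ‖a - P a‖ ^ 2 + 2 * ⟪a - P a, w⟫ ≤ ‖(a + w) - P (a + w)‖ ^ 2 := by
  have h1 := hP a (P (a + w)) (hPK _)
  have h2 : ‖(a + w) - P (a + w)‖ ^ 2 = ‖a - P a‖ ^ 2
      + 2 * (⟪a - P a, w⟫ - ⟪a - P a, P (a + w) - P a⟫) + ‖w - (P (a + w) - P a)‖ ^ 2 := by
    rw [show (a + w) - P (a + w) = (a - P a) + (w - (P (a + w) - P a)) by abel, norm_add_sq_real,
      inner_sub_right (a - P a) w]
  nlinarith [sq_nonneg ‖w - (P (a + w) - P a)‖]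

omit hPK in
theorem norm_residual_le (z : E) {y : E} (hy : y ∈ K) : ‖z - P z‖ ^ 2 ≤ ‖z - y‖ ^ 2 := by
  have h1 := hP z y hy
  have h2 : ‖z - y‖ ^ 2 = ‖z - P z‖ ^ 2 - 2 * ⟪z - P z, y - P z⟫ + ‖y - P z‖ ^ 2 := by
    rw [← norm_sub_sq_real]
    congr 2
    abel
  nlinarith [sq_nonneg ‖y - P z‖]

/-- A support point `x` for `v` satisfies `P (x + v) = x`; this makes the residual surjective when
`K` is compact. -/
theorem residual_eq_of_isMaxOn {x v : E} (hx : x ∈ K) (hmax : ∀ y ∈ K, ⟪v, y⟫ ≤ ⟪v, x⟫) :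
    (x + v) - P (x + v) = v := by
  have h1 := hP (x + v) x hx
  have h2 := hmax _ (hPK (x + v))
  have h3 : ⟪(x + v) - P (x + v), x - P (x + v)⟫
      = ‖x - P (x + v)‖ ^ 2 + (⟪v, x⟫ - ⟪v, P (x + v)⟫) := by
    rw [← real_inner_self_eq_norm_sq]
    simp only [inner_sub_left, inner_sub_right, inner_add_left]
    ring
  have h4 : ‖x - P (x + v)‖ = 0 := by
    have := sq_nonneg ‖x - P (x + v)‖
    exact pow_eq_zero_iff two_ne_zero |>.1 (by linarith)
  rw [add_sub_right_comm, norm_eq_zero.1 h4, zero_add]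

/-- With `w = y - P z`, the squared distance to `K` at `z + w` is at most that at `z`. Bounding it
below by two half steps of the gradient inequality, the gradient at the midpoint exceeds that at `z`
in the direction `w` by a quadratic term, because the residual is firmly nonexpansive and expanding.
-/
theorem sq_dist_le_of_expanding {z : E} {c r : ℝ} (hc : 0 < c)
    (hexp : ∀ w, ‖w‖ ≤ r → c * ‖w‖ ≤ ‖((z + w) - P (z + w)) - (z - P z)‖)
    {y : E} (hy : y ∈ K) (hyr : ‖y - P z‖ ≤ r) :
    c ^ 2 / 2 * ‖y - P z‖ ^ 2 ≤ 2 * ⟪z - P z, P z - y⟫ := by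
  set w := y - P z with hw
  have e1 := norm_residual_le hP (z + w) hy
  rw [show z + w - y = z - P z by rw [hw]; abel] at e1
  have hhalf : ‖(1 / 2 : ℝ) • w‖ = ‖w‖ / 2 := by
    rw [norm_smul]; norm_num; ring
  have e2 := norm_sq_residual_add_le hPK hP z ((1 / 2 : ℝ) • w)
  have e3 := norm_sq_residual_add_le hPK hP (z + (1 / 2 : ℝ) • w) ((1 / 2 : ℝ) • w)
  rw [show z + (1 / 2 : ℝ) • w + (1 / 2 : ℝ) • w = z + w by
    rw [add_assoc, ← add_smul]; norm_num] at e3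
  have e4 := norm_sq_residual_sub_le hPK hP (z + (1 / 2 : ℝ) • w) z
  rw [add_sub_cancel_left] at e4
  have e5 := hexp ((1 / 2 : ℝ) • w) (by rw [hhalf]; linarith [norm_nonneg w])
  rw [hhalf] at e5
  have e6 : (c * (‖w‖ / 2)) ^ 2
      ≤ ‖z + (1 / 2 : ℝ) • w - P (z + (1 / 2 : ℝ) • w) - (z - P z)‖ ^ 2 :=
    pow_le_pow_left₀ (by positivity) e5 2
  rw [inner_sub_left] at e4
  simp only [inner_smul_right] at e2 e3 e4
  have e7 : ⟪z - P z, P z - y⟫ = -⟪z - P z, w⟫ := by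
    rw [← inner_neg_right, hw, neg_sub]
  rw [e7]
  nlinarith

theorem insideParaboloid_of_expanding (hconv : Convex ℝ K) (hbdd : Bornology.IsBounded K)
    {z : E} {c r : ℝ} (hc : 0 < c) (hr : 0 < r)
    (hexp : ∀ w, ‖w‖ ≤ r → c * ‖w‖ ≤ ‖((z + w) - P (z + w)) - (z - P z)‖) :
    InsideParaboloid K (z - P z) := by
  obtain ⟨R, hR⟩ := hbdd.subset_closedBall (P z)
  set s := min 1 (r / (max R 1)) with hs
  have hR1 : 0 < max R 1 := by positivity
  have hs0 : 0 < s := lt_min one_pos (by positivity)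
  refine ⟨P z, hPK z, 4 / (c ^ 2 * s), by positivity, fun y hy => ?_⟩
  -- Shrinking by `s` brings all of `K` within the radius `r`; undoing it costs a factor `1 / s`,
  -- since one side is quadratic and the other linear.
  have hmem : P z + s • (y - P z) ∈ K := hconv.add_smul_sub_mem (hPK z) hy ⟨hs0.le, min_le_left _ _⟩
  have hyR : ‖y - P z‖ ≤ max R 1 := by
    have := hR hy
    rw [Metric.mem_closedBall, dist_eq_norm] at this
    exact this.trans (le_max_left _ _)
  have hn : ‖s • (y - P z)‖ = s * ‖y - P z‖ := by rw [norm_smul, Real.norm_of_nonneg hs0.le]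
  have hle : s * ‖y - P z‖ ≤ r := by
    calc s * ‖y - P z‖ ≤ r / (max R 1) * max R 1 := by
          gcongr
          exact min_le_right _ _
      _ = r := by field_simp
  have key := sq_dist_le_of_expanding hPK hP hc hexp hmem (by rw [add_sub_cancel_left, hn]; exact hle)
  rw [add_sub_cancel_left, hn, show P z - (P z + s • (y - P z)) = s • (P z - y) by
    rw [sub_add_cancel_left, ← smul_neg, neg_sub], inner_smul_right] at key
  have key' : c ^ 2 * s * ‖y - P z‖ ^ 2 ≤ 4 * ⟪z - P z, P z - y⟫ := by
    refine le_of_mul_le_mul_left ?_ hs0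
    nlinarith
  rw [div_mul_eq_mul_div, le_div_iff₀ (by positivity)]
  linarith

theorem insideParaboloid_of_hasFDerivAt (hconv : Convex ℝ K) (hbdd : Bornology.IsBounded K)
    [FiniteDimensional ℝ E] {z : E} {A : E →L[ℝ] E}
    (hA : HasFDerivAt (fun z => z - P z) A z) (hdet : A.det ≠ 0) :
    InsideParaboloid K (z - P z) := by
  have hanti : ∃ C, AntilipschitzWith C A := by
    let e := A.toContinuousLinearEquivOfDetNeZero hdet
    exact ⟨_, e.antilipschitz⟩
  obtain ⟨C, hC⟩ := hanti
  have hO : (fun y => y - z) =O[𝓝 z] fun y => (y - P y) - (z - P z) := by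
    have h1 : (fun y => y - z) =O[𝓝 z] fun y => A (y - z) :=
      Asymptotics.isBigO_iff.2 ⟨C, Eventually.of_forall fun y => by
        simpa using hC.le_mul_dist (y - z) 0⟩
    have h2 : Asymptotics.IsEquivalent (𝓝 z) (fun y => (y - P y) - (z - P z)) fun y => A (y - z) :=
      hA.isLittleO.trans_isBigO h1
    exact h1.trans h2.isBigO_symm
  obtain ⟨c, hc, hO⟩ := hO.exists_pos
  rw [Asymptotics.IsBigOWith_def] at hO
  obtain ⟨r, hr, hball⟩ := Metric.nhds_basis_closedBall.eventually_iff.1 hO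
  refine insideParaboloid_of_expanding hPK hP hconv hbdd (inv_pos.2 hc) hr (z := z) fun w hw => ?_
  have := @hball (z + w) (by simpa using hw)
  rw [add_sub_cancel_left] at this
  rw [inv_mul_le_iff₀ hc]
  exact this

end Projection

/-! ### Paraboloids for almost every direction -/

theorem ae_insideParaboloid {E : Type*} [NormedAddCommGroup E] [InnerProductSpace ℝ E]
    [FiniteDimensional ℝ E] [MeasurableSpace E] [BorelSpace E] (μ : Measure E)
    [μ.IsAddHaarMeasure] {K : Set E} (hne : K.Nonempty) (hK : IsCompact K) (hconv : Convex ℝ K) :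
    ∀ᵐ v ∂μ, InsideParaboloid K v := by
  obtain ⟨P, hPK, hP⟩ := exists_metricProjection hne hK.isClosed hconv
  set J : E → E := fun z => z - P z with hJ
  have hlip : LipschitzWith 1 J := lipschitzWith_residual hPK hP
  have hsurj : ∀ v, ∃ z, J z = v := fun v => by
    obtain ⟨x, hx, hmax⟩ := hK.exists_isMaxOn hne
      (f := fun y => ⟪v, y⟫) (by fun_prop)
    exact ⟨x + v, residual_eq_of_isMaxOn hPK hP hx fun y hy => hmax hy⟩
  -- Lipschitz maps send Hausdorff-null sets to null sets, so Rademacher's exceptional set has null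
  -- image.
  have hnd : μ (J '' {z | ¬ DifferentiableAt ℝ J z}) = 0 := by
    apply Measure.absolutelyContinuous_isAddHaarMeasure μ μH[Module.finrank ℝ E]
    refine le_antisymm ((hlip.hausdorffMeasure_image_le (Nat.cast_nonneg _) _).trans ?_) zero_le
    have : μH[Module.finrank ℝ E] {z | ¬ DifferentiableAt ℝ J z} = 0 := hlip.ae_differentiableAt
    simp [this]
  have hcrit : μ (J '' {z | DifferentiableAt ℝ J z ∧ (fderiv ℝ J z).det = 0}) = 0 :=
    addHaar_image_eq_zero_of_det_fderivWithin_eq_zero μ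
      (fun z hz => hz.1.hasFDerivAt.hasFDerivWithinAt) fun z hz => hz.2
  filter_upwards [measure_eq_zero_iff_ae_notMem.1 hnd, measure_eq_zero_iff_ae_notMem.1 hcrit]
    with v h1 h2
  obtain ⟨z, rfl⟩ := hsurj v
  have hd : DifferentiableAt ℝ J z := by
    by_contra h
    exact h1 ⟨z, h, rfl⟩
  exact insideParaboloid_of_hasFDerivAt hPK hP hconv hK.isBounded hd.hasFDerivAt
    fun h => h2 ⟨z, ⟨hd, h⟩, rfl⟩

/-- Polar coordinates: for almost every `ω` the property holds at `r • ω` for almost every `r`,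
hence for some `r`, the radial measure being nonzero. -/
theorem ae_toSphere_of_ae {E : Type*} [NormedAddCommGroup E] [NormedSpace ℝ E]
    [FiniteDimensional ℝ E] [MeasurableSpace E] [BorelSpace E] (μ : Measure E)
    [μ.IsAddHaarMeasure] {p : E → Prop} (hp : ∀ r : ℝ, 0 < r → ∀ v, p (r • v) → p v)
    (h : ∀ᵐ v ∂μ, p v) : ∀ᵐ ω : Metric.sphere (0 : E) 1 ∂μ.toSphere, p ω := by
  have hcomap : ∀ᵐ v : ({0}ᶜ : Set E) ∂(μ.comap (Subtype.val : ({0}ᶜ : Set E) → E)), p v := by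
    have hemb : MeasurableEmbedding (Subtype.val : ({0}ᶜ : Set E) → E) :=
      MeasurableEmbedding.subtype_coe (measurableSet_singleton _).compl
    rw [← hemb.ae_map_iff, hemb.map_comap]
    exact ae_restrict_of_ae h
  have hprod : ∀ᵐ q ∂(μ.toSphere.prod (Measure.volumeIoiPow (Module.finrank ℝ E - 1))),
      p ((q.2 : ℝ) • (q.1 : E)) := by
    rw [← μ.measurePreserving_homeomorphUnitSphereProd.map_eq,
      (homeomorphUnitSphereProd E).measurableEmbedding.ae_map_iff]
    filter_upwards [hcomap] with v hv
    rw [← homeomorphUnitSphereProd_symm_apply_coe, Homeomorph.symm_apply_apply]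
    exact hv
  have hne : (ae (Measure.volumeIoiPow (Module.finrank ℝ E - 1))).NeBot := by
    rw [ae_neBot]
    intro h0
    have h1 := Measure.volumeIoiPow_apply_Iio (Module.finrank ℝ E - 1) ⟨1, Set.mem_Ioi.2 one_pos⟩
    rw [h0, Measure.coe_zero, Pi.zero_apply, eq_comm, ENNReal.ofReal_eq_zero] at h1
    exact absurd h1 (not_le.2 (by positivity))
  filter_upwards [Measure.ae_ae_of_ae_prod hprod] with ω hω
  obtain ⟨r, hr⟩ := hω.exists
  exact hp r r.2 ω hr

theorem InsideParaboloid.of_smul {E : Type*} [NormedAddCommGroup E] [InnerProductSpace ℝ E]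
    {K : Set E} {v : E} {r : ℝ} (hr : 0 < r) (h : InsideParaboloid K (r • v)) :
    InsideParaboloid K v := by
  obtain ⟨x, hx, C, hC, hle⟩ := h
  refine ⟨x, hx, C * r, by positivity, fun y hy => ?_⟩
  rw [mul_assoc, ← real_inner_smul_left]
  exact hle y hy


/-! ### Vanishing order of a polynomial -/

theorem Polynomial.X_sub_C_pow_dvd_of_abs_eval_le {p : ℝ[X]} {m : ℕ} {a A : ℝ} {S : Set ℝ}
    (ha : a ∈ closure (S ∩ {a}ᶜ)) (hp : ∀ t ∈ S, |p.eval t| ≤ A * |t - a| ^ m) :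
    (X - C a) ^ m ∣ p := by
  have key : ∀ k ≤ m, (X - C a) ^ k ∣ p := by
    intro k
    induction k with
    | zero => simp
    | succ k ih =>
      intro hk
      obtain ⟨q, hq⟩ := ih (by omega)
      -- After cancelling `|t - a| ^ k`, the bound passes to the limit `t = a`; the remaining
      -- exponent `m - k` is positive, so `q` vanishes there.
      have hcl : IsClosed {t | |q.eval t| ≤ A * |t - a| ^ (m - k)} :=
        isClosed_le (by fun_prop) (by fun_prop)
      have hsub : S ∩ {a}ᶜ ⊆ {t | |q.eval t| ≤ A * |t - a| ^ (m - k)} := by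
        rintro t ⟨ht, hta⟩
        have hpos : 0 < |t - a| ^ k := pow_pos (abs_pos.2 (sub_ne_zero.2 hta)) _
        have h := hp t ht
        rw [hq, eval_mul, eval_pow, eval_sub, eval_X, eval_C, abs_mul, abs_pow,
          ← Nat.add_sub_cancel' (show k ≤ m by omega), pow_add] at h
        refine le_of_mul_le_mul_left ?_ hpos
        linarith
      have h := closure_minimal hsub hcl ha
      simp only [Set.mem_ofPred_eq, sub_self, abs_zero] at h
      rw [zero_pow (by omega), mul_zero] at h
      have hroot : (X - C a) ∣ q := dvd_iff_isRoot.2 (abs_nonpos_iff.1 h)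
      rw [hq, pow_succ]
      exact mul_dvd_mul_left _ hroot
  exact key m le_rfl

/-! ### Volumes of hyperplane sections -/

variable {n : ℕ}

instance isAddHaarMeasure_volume_orthogonal (v : EuclideanSpace ℝ (Fin n)) :
    (@volume ((ℝ ∙ v)ᗮ) measureSpaceOfInnerProductSpace).IsAddHaarMeasure :=
  inferInstanceAs (((stdOrthonormalBasis ℝ ((ℝ ∙ v)ᗮ)).toBasis.addHaar).IsAddHaarMeasure)

theorem inner_add_smul_of_mem_orthogonal (ω : Metric.sphere (0 : EuclideanSpace ℝ (Fin n)) 1)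
    (y : (ℝ ∙ (ω : EuclideanSpace ℝ (Fin n)))ᗮ) (t : ℝ) :
    ⟪(ω : EuclideanSpace ℝ (Fin n)), (y : EuclideanSpace ℝ (Fin n)) + t • ω⟫ = t := by
  rw [inner_add_right, inner_smul_right, Submodule.mem_orthogonal_singleton_iff_inner_right.1 y.2,
    real_inner_self_eq_norm_sq, norm_eq_of_mem_sphere]
  norm_num

theorem finrank_orthogonal_unit (ω : Metric.sphere (0 : EuclideanSpace ℝ (Fin n)) 1) :
    Module.finrank ℝ ((ℝ ∙ (ω : EuclideanSpace ℝ (Fin n)))ᗮ) = n - 1 := by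
  have h := Submodule.finrank_add_finrank_orthogonal (ℝ ∙ (ω : EuclideanSpace ℝ (Fin n)))
  rw [finrank_span_singleton (ne_zero_of_mem_unit_sphere ω), finrank_euclideanSpace_fin] at h
  omega

variable {D : Set (EuclideanSpace ℝ (Fin n))}

theorem volume_section_le {m : ℕ} (hm : n - 1 = 2 * m)
    (ω : Metric.sphere (0 : EuclideanSpace ℝ (Fin n)) 1) {t ρ : ℝ} (hρ : 0 ≤ ρ)
    {x : EuclideanSpace ℝ (Fin n)}
    (h : ∀ y ∈ D, ⟪(ω : EuclideanSpace ℝ (Fin n)), y⟫ = t → ‖y - x‖ ^ 2 ≤ ρ) :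
    (@volume ((ℝ ∙ (ω : EuclideanSpace ℝ (Fin n)))ᗮ) measureSpaceOfInnerProductSpace)
      {y | (y : EuclideanSpace ℝ (Fin n)) + t • (ω : EuclideanSpace ℝ (Fin n)) ∈ D} ≤
    ENNReal.ofReal ((4 * ρ) ^ m) *
      (@volume ((ℝ ∙ (ω : EuclideanSpace ℝ (Fin n)))ᗮ) measureSpaceOfInnerProductSpace)
        (Metric.ball 0 1) := by
  set S := {y : (ℝ ∙ (ω : EuclideanSpace ℝ (Fin n)))ᗮ |
    (y : EuclideanSpace ℝ (Fin n)) + t • (ω : EuclideanSpace ℝ (Fin n)) ∈ D} with hS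
  rcases S.eq_empty_or_nonempty with hemp | ⟨y₀, hy₀⟩
  · rw [hemp, measure_empty]
    exact zero_le
  have hnorm : ∀ y ∈ S, ‖(y : EuclideanSpace ℝ (Fin n)) + t • ω - x‖ ≤ √ρ := fun y hy =>
    Real.le_sqrt_of_sq_le (h _ hy (inner_add_smul_of_mem_orthogonal ω y t))
  -- The point `x` need not lie in the hyperplane, so the ball is recentred at a point of the
  -- section. Doubling the radius produces the factor `4`.
  have hsub : S ⊆ Metric.closedBall y₀ (2 * √ρ) := by
    intro y hy
    rw [Metric.mem_closedBall, dist_eq_norm, ← Submodule.norm_coe, Submodule.coe_sub]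
    calc ‖(y : EuclideanSpace ℝ (Fin n)) - y₀‖
        = ‖((y : EuclideanSpace ℝ (Fin n)) + t • ω - x) - (y₀ + t • ω - x)‖ := by
          congr 1
          abel
      _ ≤ √ρ + √ρ := (norm_sub_le _ _).trans (add_le_add (hnorm y hy) (hnorm y₀ hy₀))
      _ = 2 * √ρ := by ring
  refine (measure_mono hsub).trans (le_of_eq ?_)
  rw [Measure.addHaar_closedBall _ _ (by positivity), finrank_orthogonal_unit, hm, pow_mul,
    mul_pow, Real.sq_sqrt hρ]
  norm_num

theorem sectionVolume_le_of_paraboloid {m : ℕ} (hm : n - 1 = 2 * m)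
    (ω : Metric.sphere (0 : EuclideanSpace ℝ (Fin n)) 1) {C : ℝ} (hC : 0 < C)
    {x : EuclideanSpace ℝ (Fin n)}
    (h : ∀ y ∈ D, ‖y - x‖ ^ 2 ≤ C * |⟪(ω : EuclideanSpace ℝ (Fin n)), x - y⟫|) :
    ∃ A : ℝ, ∀ t, sectionVolume D ω t ≤ A * |t - ⟪(ω : EuclideanSpace ℝ (Fin n)), x⟫| ^ m := by
  refine ⟨(4 * C) ^ m *
    (@volume ((ℝ ∙ (ω : EuclideanSpace ℝ (Fin n)))ᗮ) measureSpaceOfInnerProductSpace).real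
      (Metric.ball 0 1), fun t => ?_⟩
  have h1 := volume_section_le (D := D) hm ω (t := t) (x := x)
    (ρ := C * |t - ⟪(ω : EuclideanSpace ℝ (Fin n)), x⟫|) (by positivity) fun y hy hyt => by
      rw [← hyt, abs_sub_comm, ← inner_sub_right]
      exact h y hy
  have h2 := ENNReal.toReal_mono
    (ENNReal.mul_ne_top ENNReal.ofReal_ne_top measure_ball_lt_top.ne) h1
  rw [ENNReal.toReal_mul, ENNReal.toReal_ofReal (by positivity)] at h2
  refine h2.trans (le_of_eq ?_)
  rw [← mul_assoc 4, mul_pow (4 * C), measureReal_def]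
  ring

theorem sectionVolume_pos (hD : IsOpen D) (hb : Bornology.IsBounded D)
    {ω : Metric.sphere (0 : EuclideanSpace ℝ (Fin n)) 1} {t : ℝ} (ht : HyperplaneHits D ω t) :
    0 < sectionVolume D ω t := by
  obtain ⟨x, hx, hxt⟩ := ht
  set S := {y : (ℝ ∙ (ω : EuclideanSpace ℝ (Fin n)))ᗮ |
    (y : EuclideanSpace ℝ (Fin n)) + t • (ω : EuclideanSpace ℝ (Fin n)) ∈ D} with hS
  have hopen : IsOpen S := hD.preimage (by fun_prop)
  have hmem : x - t • (ω : EuclideanSpace ℝ (Fin n)) ∈ (ℝ ∙ (ω : EuclideanSpace ℝ (Fin n)))ᗮ := by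
    rw [Submodule.mem_orthogonal_singleton_iff_inner_right, inner_sub_right, inner_smul_right, hxt,
      real_inner_self_eq_norm_sq, norm_eq_of_mem_sphere]
    norm_num
  have hne : S.Nonempty := ⟨⟨_, hmem⟩, by simpa [hS] using hx⟩
  have hbd : Bornology.IsBounded S := by
    obtain ⟨R, hR⟩ := hb.subset_closedBall (t • (ω : EuclideanSpace ℝ (Fin n)))
    refine (Metric.isBounded_closedBall (x := 0) (r := R)).subset fun y hy => ?_
    have := hR hy
    rw [Metric.mem_closedBall, dist_eq_norm, add_sub_cancel_right] at this
    simpa using this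
  exact ENNReal.toReal_pos (hopen.measure_pos _ hne).ne' hbd.measure_lt_top.ne

theorem setOf_hyperplaneHits_eq_image (ω : Metric.sphere (0 : EuclideanSpace ℝ (Fin n)) 1) :
    {t | HyperplaneHits D ω t} = innerSL ℝ (ω : EuclideanSpace ℝ (Fin n)) '' D := by
  ext t
  simp [HyperplaneHits]

theorem isOpen_setOf_hyperplaneHits (hD : IsOpen D)
    (ω : Metric.sphere (0 : EuclideanSpace ℝ (Fin n)) 1) : IsOpen {t | HyperplaneHits D ω t} := by
  rw [setOf_hyperplaneHits_eq_image]
  refine (innerSL ℝ (ω : EuclideanSpace ℝ (Fin n))).isOpenMap (fun t => ⟨t • ω, ?_⟩) D hD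
  rw [innerSL_apply_apply, inner_smul_right, real_inner_self_eq_norm_sq, norm_eq_of_mem_sphere]
  norm_num

/-- Connectedness makes the set of hitting values an interval, so the preimage of its closure is
closed, convex and contains `D`. -/
theorem inner_mem_closure_hyperplaneHits (hD : IsConnected D)
    (ω : Metric.sphere (0 : EuclideanSpace ℝ (Fin n)) 1) {x : EuclideanSpace ℝ (Fin n)}
    (hx : x ∈ closure (convexHull ℝ D)) :
    ⟪(ω : EuclideanSpace ℝ (Fin n)), x⟫ ∈ closure {t | HyperplaneHits D ω t} := by
  set L := innerSL ℝ (ω : EuclideanSpace ℝ (Fin n)) with hL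
  have hconv : Convex ℝ {t | HyperplaneHits D ω t} := by
    rw [setOf_hyperplaneHits_eq_image]
    exact (hD.isPreconnected.image L L.continuous.continuousOn).ordConnected.convex
  have hsub : closure (convexHull ℝ D) ⊆ L ⁻¹' closure {t | HyperplaneHits D ω t} := by
    refine closure_minimal (convexHull_min (fun y hy => subset_closure ⟨y, hy, rfl⟩) ?_)
      (isClosed_closure.preimage L.continuous)
    exact hconv.closure.linear_preimage L.toLinearMap
  exact hsub hx

theorem infinite_setOf_hyperplaneHits (hD : IsOpen D) (hne : D.Nonempty)
    (ω : Metric.sphere (0 : EuclideanSpace ℝ (Fin n)) 1) :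
    {t | HyperplaneHits D ω t}.Infinite := by
  obtain ⟨x, hx⟩ := hne
  exact infinite_of_mem_nhds _ ((isOpen_setOf_hyperplaneHits hD ω).mem_nhds ⟨x, hx, rfl⟩)

theorem IsSectionPolynomial.eq (hD : IsOpen D) (hne : D.Nonempty)
    {ω : Metric.sphere (0 : EuclideanSpace ℝ (Fin n)) 1} {p q : ℝ[X]}
    (hp : IsSectionPolynomial D ω p) (hq : IsSectionPolynomial D ω q) : p = q :=
  eq_of_infinite_eval_eq p q <| (infinite_setOf_hyperplaneHits hD hne ω).mono fun t ht =>
    (hp t ht).symm.trans (hq t ht)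

theorem IsSectionPolynomial.X_sub_C_pow_dvd {m : ℕ} (hm : n - 1 = 2 * m) (hD : IsOpen D)
    (hconn : IsConnected D) {ω : Metric.sphere (0 : EuclideanSpace ℝ (Fin n)) 1} {p : ℝ[X]}
    (hp : IsSectionPolynomial D ω p) {c : ℝ} (hc : 0 < c) {x : EuclideanSpace ℝ (Fin n)}
    (hx : x ∈ closure (convexHull ℝ D))
    (h : ∀ y ∈ D, ‖y - x‖ ^ 2 ≤ c * |⟪(ω : EuclideanSpace ℝ (Fin n)), x - y⟫|) :
    (X - C ⟪(ω : EuclideanSpace ℝ (Fin n)), x⟫) ^ m ∣ p := by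
  obtain ⟨A, hA⟩ := sectionVolume_le_of_paraboloid hm ω hc h
  refine X_sub_C_pow_dvd_of_abs_eval_le (A := A) (S := {t | HyperplaneHits D ω t}) ?_ fun t ht => ?_
  · exact closure_minimal ((dense_compl_singleton _).open_subset_closure_inter
      (isOpen_setOf_hyperplaneHits hD ω)) isClosed_closure
      (inner_mem_closure_hyperplaneHits hconn ω hx)
  · rw [← hp t ht, abs_of_nonneg (show 0 ≤ sectionVolume D ω t from measureReal_nonneg)]
    exact hA t

/-! ### The degree bound -/

theorem IsSectionPolynomial.le_degree (hn : Odd n) (hD : IsOpen D) (hconn : IsConnected D)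
    (hb : Bornology.IsBounded D) {ω : Metric.sphere (0 : EuclideanSpace ℝ (Fin n)) 1} {p : ℝ[X]}
    (hp : IsSectionPolynomial D ω p)
    (hpos : InsideParaboloid (closure (convexHull ℝ D)) (ω : EuclideanSpace ℝ (Fin n)))
    (hneg : InsideParaboloid (closure (convexHull ℝ D)) (-ω : EuclideanSpace ℝ (Fin n))) :
    ((n - 1 : ℕ) : WithBot ℕ) ≤ p.degree := by
  obtain ⟨m, rfl⟩ := hn
  have hm : 2 * m + 1 - 1 = 2 * m := by omega
  have hDK : D ⊆ closure (convexHull ℝ D) := (subset_convexHull ℝ D).trans subset_closure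
  obtain ⟨x, hx, c, hc, hle⟩ := hpos
  obtain ⟨x', hx', c', hc', hle'⟩ := hneg
  have hdvd := hp.X_sub_C_pow_dvd hm hD hconn hc hx fun y hy =>
    (hle y (hDK hy)).trans (by gcongr; exact le_abs_self _)
  have hdvd' := hp.X_sub_C_pow_dvd hm hD hconn hc' hx' fun y hy =>
    (hle' y (hDK hy)).trans (by gcongr; rw [inner_neg_left]; exact neg_le_abs _)
  have hup : ∀ t, HyperplaneHits D ω t → t ≤ ⟪(ω : EuclideanSpace ℝ (Fin (2 * m + 1))), x⟫ := by
    rintro t ⟨y, hy, rfl⟩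
    have := (sq_nonneg _).trans (hle y (hDK hy))
    rw [inner_sub_right] at this
    linarith [nonneg_of_mul_nonneg_right this hc]
  have hlo : ∀ t, HyperplaneHits D ω t → ⟪(ω : EuclideanSpace ℝ (Fin (2 * m + 1))), x'⟫ ≤ t := by
    rintro t ⟨y, hy, rfl⟩
    have := (sq_nonneg _).trans (hle' y (hDK hy))
    rw [inner_neg_left, inner_sub_right] at this
    linarith [nonneg_of_mul_nonneg_right this hc']
  have hne : ⟪(ω : EuclideanSpace ℝ (Fin (2 * m + 1))), x⟫
      ≠ ⟪(ω : EuclideanSpace ℝ (Fin (2 * m + 1))), x'⟫ := fun heq =>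
    infinite_setOf_hyperplaneHits hD hconn.nonempty ω <|
      (Set.finite_singleton ⟪(ω : EuclideanSpace ℝ (Fin (2 * m + 1))), x⟫).subset fun t ht =>
        le_antisymm (hup t ht) (heq ▸ hlo t ht)
  -- When `m = 0` this is the whole claim, as the zero polynomial has degree `⊥`.
  have hp0 : p ≠ 0 := by
    rintro rfl
    obtain ⟨y, hy⟩ := hconn.nonempty
    have hy' : HyperplaneHits D ω ⟪(ω : EuclideanSpace ℝ (Fin (2 * m + 1))), y⟫ := ⟨y, hy, rfl⟩
    have := sectionVolume_pos hD hb hy'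
    rw [hp _ hy', eval_zero] at this
    exact this.false
  -- The two ends are distinct, so the two `m`-th powers are coprime and their product divides `p`.
  have hcop := (isCoprime_X_sub_C_of_isUnit_sub (sub_ne_zero.2 hne).isUnit).pow (m := m) (n := m)
  have hdeg := degree_le_of_dvd (hcop.mul_dvd hdvd hdvd') hp0
  rw [degree_mul, degree_pow, degree_pow, degree_X_sub_C, degree_X_sub_C] at hdeg
  refine le_trans (le_of_eq ?_) hdeg
  rw [hm, two_mul]
  simp

theorem HasPolynomialSections.isSectionPolynomial {N : ℕ}
    {a : ℕ → Metric.sphere (0 : EuclideanSpace ℝ (Fin n)) 1 → ℝ} (h : HasPolynomialSections D N a)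
    (ω : Metric.sphere (0 : EuclideanSpace ℝ (Fin n)) 1) :
    IsSectionPolynomial D ω (∑ j ∈ Finset.range (N + 1), C (a j ω) * X ^ j) := fun t ht => by
  simp [h ω t ht, eval_finsetSum]

theorem ae_toSphere_insideParaboloid {K : Set (EuclideanSpace ℝ (Fin n))} (hne : K.Nonempty)
    (hK : IsCompact K) (hconv : Convex ℝ K) :
    ∀ᵐ ω : Metric.sphere (0 : EuclideanSpace ℝ (Fin n)) 1
      ∂((volume : Measure (EuclideanSpace ℝ (Fin n))).toSphere),
      InsideParaboloid K (ω : EuclideanSpace ℝ (Fin n)) ∧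
        InsideParaboloid K (-ω : EuclideanSpace ℝ (Fin n)) := by
  have h := ae_insideParaboloid volume hne hK hconv
  refine ae_toSphere_of_ae volume
    (p := fun v => InsideParaboloid K v ∧ InsideParaboloid K (-v)) (fun r hr v hv => ⟨?_, ?_⟩)
    (h.and ((Measure.measurePreserving_neg volume).quasiMeasurePreserving.ae h))
  · exact hv.1.of_smul hr
  · have h2 := hv.2
    rw [← smul_neg] at h2
    exact h2.of_smul hr

theorem theoremT (n : ℕ) (hn : Odd n) (D : Set (EuclideanSpace ℝ (Fin n)))
    (hD : IsSmoothlyBoundedDomain D) (hpoly : IsPolynomiallyIntegrable D) :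
    (∀ᵐ ω ∂((volume : Measure (EuclideanSpace ℝ (Fin n))).toSphere),
      ∃ p : ℝ[X], (∀ q : ℝ[X], IsSectionPolynomial D ω q ↔ q = p) ∧
        ((n - 1 : ℕ) : WithBot ℕ) ≤ p.degree) ∧
    (∀ N : ℕ, IsPolynomiallyIntegrableOfDegree D N → n - 1 ≤ N) := by
  have hne := hD.isConnected.nonempty
  have hae : ∀ᵐ ω ∂((volume : Measure (EuclideanSpace ℝ (Fin n))).toSphere),
      ∃ p : ℝ[X], (∀ q : ℝ[X], IsSectionPolynomial D ω q ↔ q = p) ∧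
        ((n - 1 : ℕ) : WithBot ℕ) ≤ p.degree := by
    obtain ⟨N, a, ha⟩ := hpoly
    have hK : IsCompact (closure (convexHull ℝ D)) :=
      (isBounded_convexHull.2 hD.isBounded).isCompact_closure
    filter_upwards [ae_toSphere_insideParaboloid (hne.convexHull (𝕜 := ℝ)).closure hK
      (convex_convexHull ℝ D).closure] with ω hω
    have hp := ha.isSectionPolynomial ω
    refine ⟨_, fun q => ⟨fun hq => hq.eq hD.isOpen hne hp, fun hq => hq ▸ hp⟩,
      hp.le_degree hn hD.isOpen hD.isConnected hD.isBounded hω.1 hω.2⟩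
  refine ⟨hae, fun N hN => ?_⟩
  obtain ⟨a, ha, -⟩ := hN
  have : Nonempty (Fin n) := ⟨⟨0, hn.pos⟩⟩
  -- A single direction from the almost-everywhere statement suffices to bound `N`.
  have hsphere : (ae ((volume : Measure (EuclideanSpace ℝ (Fin n))).toSphere)).NeBot :=
    ae_neBot.2 (Measure.toSphere_ne_zero _)
  obtain ⟨ω, p, hp, hdeg⟩ := hae.exists
  have hpa := (hp _).1 (ha.isSectionPolynomial ω)
  have hle : p.degree ≤ (N : WithBot ℕ) := by
    rw [← hpa]
    refine (degree_sum_le _ _).trans (Finset.sup_le fun j hj => (degree_C_mul_X_pow_le _ _).trans ?_)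
    exact_mod_cast Finset.mem_range_succ_iff.1 hj
  exact_mod_cast hdeg.trans hle
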